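/- An $\ell$-group is a topological group whose underlying space is Hausdorff, locally compact and totally disconnected. An $\ell_c$-group is an $\ell$-group $G$ that is the filtered union of its compact open subgroups: every element of $G$ lies in a compact open subgroup, and any two compact open subgroups are contained in a third. A complex representation $(\pi,V)$ of $G$ is smooth if the action map $G\times V\to V$ is continuous for the discrete topology on $V$, and admissible if moreover for every compact open subgroup $K\subset G$ the space $V^K$ of $K$-fixed vectors is finite-dimensional. The group $G$ is tame if all its irreducible smooth representations are admissible. Let $\widehat G$ be the set of isomorphism classes of irreducible smooth representations of $G$. The smooth dual $V^\vee$ of $(\pi,V)$ is the space of vectors with open stabilizer in the full linear dual $V^*$. The Fell topology on $\widehat G$ is the topology in which a basis of neighborhoods of $(\pi,V)\in\widehat G$ is formed by the sets $\mathscr U(\pi,v_j,\xi_j,B,\epsilon)$, for finitely many $v_1,\dots,v_n\in V$ and $\xi_1,\dots,\xi_n\in V^\vee$, a compact subset $B\subset G$ and $\epsilon>0$; here $\mathscr U(\pi,v_j,\xi_j,B,\epsilon)$ consists of those $(\rho,W)\in\widehat G$ for which there are $w_1,\dots,w_n\in W$ and $\zeta_1,\dots,\zeta_n\in W^\vee$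 with \[ \bigl|\langle \xi_j,\pi(g)v_j\rangle-\langle\zeta_j,\rho(g)w_j\rangle\bigr|<\epsilon \qquad\text{for all } 1\le j\le n \text{ and } g\in B. \] **Corollary.** For any tame $\ell_c$-group $G$, the Fell topology on $\widehat G$ is $T_1$, i.e. points are closed. -/

import Mathlib

universe u

/-- An `ℓ`-group: a topological group whose underlying space is Hausdorff, locally compact and
totally disconnected. -/
class IsLGroup (G : Type u) [Group G] [TopologicalSpace G] : Prop extends
  IsTopologicalGroup G, T2Space G, LocallyCompactSpace G, TotallyDisconnectedSpace G

/-- A subgroup that is compact and open as a subset. -/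
def Subgroup.IsCompactOpen {G : Type u} [Group G] [TopologicalSpace G] (K : Subgroup G) : Prop :=
  IsCompact (K : Set G) ∧ IsOpen (K : Set G)

/-- An `ℓ_c`-group: an `ℓ`-group that is a filtered union of its compact open subgroups. -/
class IsLcGroup (G : Type u) [Group G] [TopologicalSpace G] : Prop extends IsLGroup G where
  exists_mem_compactOpen : ∀ g : G, ∃ K : Subgroup G, K.IsCompactOpen ∧ g ∈ K
  directed_compactOpen : ∀ K L : Subgroup G, K.IsCompactOpen → L.IsCompactOpen →
    ∃ M : Subgroup G, M.IsCompactOpen ∧ K ≤ M ∧ L ≤ M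

namespace Representation

variable {G : Type u} [Group G] [TopologicalSpace G] {V : Type*} [AddCommGroup V] [Module ℂ V]

/-- A complex representation of `G` is smooth if the action map `G × V → V` is continuous when `V`
carries the discrete topology. -/
def IsSmooth (ρ : Representation ℂ G V) : Prop :=
  letI : TopologicalSpace V := ⊥
  Continuous fun p : G × V => ρ p.1 p.2

/-- The smooth part of a representation: the vectors whose stabilizer is open in `G`. -/
def smoothPart [IsTopologicalGroup G] (ρ : Representation ℂ G V) : Submodule ℂ V where
  carrier := {v | IsOpen {g : G | ρ g v = v}}
  zero_mem' := by simp
  add_mem' := by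
    intro a b ha hb
    let S : Subgroup G :=
      { carrier := {g | ρ g a = a ∧ ρ g b = b}
        one_mem' := by simp
        mul_mem' := by
          rintro g h ⟨h₁, h₂⟩ ⟨h₃, h₄⟩
          simp [h₁, h₂, h₃, h₄]
        inv_mem' := by
          rintro g ⟨h₁, h₂⟩
          constructor
          · nth_rewrite 1 [← h₁]; simp
          · nth_rewrite 1 [← h₂]; simp }
    let T : Subgroup G :=
      { carrier := {g | ρ g (a + b) = a + b}
        one_mem' := by simp
        mul_mem' := by
          intro g h hg hh
          change ρ (g * h) (a + b) = a + b
          change ρ g (a + b) = a + b at hg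
          change ρ h (a + b) = a + b at hh
          rw [map_mul, Module.End.mul_apply, hh, hg]
        inv_mem' := by
          intro g hg
          change ρ g⁻¹ (a + b) = a + b
          change ρ g (a + b) = a + b at hg
          nth_rewrite 1 [← hg]; simp }
    have hS : IsOpen (S : Set G) := IsOpen.inter ha hb
    have hST : S ≤ T := fun g hg => by
      change ρ g (a + b) = a + b
      rw [map_add, hg.1, hg.2]
    exact Subgroup.isOpen_mono hST hS
  smul_mem' := by
    intro c a ha
    by_cases hc : c = 0
    · simp [hc]
    · have : {g : G | ρ g (c • a) = c • a} = {g : G | ρ g a = a} := by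
        ext g
        change ρ g (c • a) = c • a ↔ ρ g a = a
        rw [map_smul]
        exact (smul_right_injective V hc).eq_iff
      change IsOpen {g : G | ρ g (c • a) = c • a}
      rw [this]
      exact ha

/-- The smooth dual of a representation: the smooth part of its full linear dual. -/
def smoothDual [IsTopologicalGroup G] (ρ : Representation ℂ G V) :
    Submodule ℂ (Module.Dual ℂ V) :=
  ρ.dual.smoothPart

/-- A representation is admissible if it is smooth and, for every compact open subgroup `K`, its
space of `K`-invariant vectors is finite-dimensional. -/
def IsAdmissible (ρ : Representation ℂ G V) : Prop :=
  ρ.IsSmooth ∧ ∀ K : Subgroup G, K.IsCompactOpen →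
    FiniteDimensional ℂ (invariants (ρ.comp K.subtype))

end Representation

/-- A topological group is tame if all its irreducible smooth representations are admissible.
(An irreducible representation of `G : Type u` is generated by one vector, hence is isomorphic to a
quotient of `ℂ[G]`; so all of them occur, up to isomorphism, on spaces in `Type u`.) -/
def IsTame (G : Type u) [Group G] [TopologicalSpace G] : Prop :=
  ∀ (V : Type u) [AddCommGroup V] [Module ℂ V] (ρ : Representation ℂ G V),
    ρ.IsIrreducible → ρ.IsSmooth → ρ.IsAdmissible

/-- An irreducible smooth complex representation of `G`. -/
structure IrrSmoothRep (G : Type u) [Group G] [TopologicalSpace G] where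
  /-- the underlying space -/
  V : Type u
  [addCommGroup : AddCommGroup V]
  [module : Module ℂ V]
  /-- the action -/
  ρ : Representation ℂ G V
  irreducible : ρ.IsIrreducible
  smooth : ρ.IsSmooth

attribute [instance] IrrSmoothRep.addCommGroup IrrSmoothRep.module

/-- Isomorphism of irreducible smooth representations. -/
instance IrrSmoothRep.setoid (G : Type u) [Group G] [TopologicalSpace G] :
    Setoid (IrrSmoothRep G) where
  r π σ := Nonempty (π.ρ.Equiv σ.ρ)
  iseqv :=
    { refl := fun _ => ⟨.refl _⟩
      symm := fun ⟨e⟩ => ⟨e.symm⟩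
      trans := fun ⟨e⟩ ⟨f⟩ => ⟨e.trans f⟩ }

/-- The smooth dual space of `G`: isomorphism classes of irreducible smooth representations. -/
def SmoothDualSpace (G : Type u) [Group G] [TopologicalSpace G] : Type (u + 1) :=
  Quotient (IrrSmoothRep.setoid G)

namespace SmoothDualSpace

variable {G : Type u} [Group G] [TopologicalSpace G]

/-- The isomorphism class of an irreducible smooth representation. -/
def mk (π : IrrSmoothRep G) : SmoothDualSpace G := Quotient.mk _ π

/-- The basic Fell neighborhood `U(π, v, ξ, B, ε)` of `π`: the classes of those `σ` for which there
are vectors `w j` of `σ` and `ζ j` in its smooth dual such that the matrix coefficients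
`⟨ξ j, π g (v j)⟩` and `⟨ζ j, σ g (w j)⟩` differ by less than `ε` for all `j` and all `g ∈ B`. -/
def fellNhd [IsTopologicalGroup G] (π : IrrSmoothRep G) {n : ℕ} (v : Fin n → π.V)
    (ξ : Fin n → π.ρ.smoothDual) (B : Set G) (ε : ℝ) : Set (SmoothDualSpace G) :=
  {x | ∃ σ : IrrSmoothRep G, mk σ = x ∧
    ∃ (w : Fin n → σ.V) (ζ : Fin n → σ.ρ.smoothDual), ∀ j, ∀ g ∈ B,
      ‖(ξ j : Module.Dual ℂ π.V) (π.ρ g (v j)) - (ζ j : Module.Dual ℂ σ.V) (σ.ρ g (w j))‖ < ε}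

/-- The Fell topology: a set is open if with each point `π` it contains some `U(π, v, ξ, B, ε)` with
`B` compact and `ε > 0`. -/
instance fellTopology [IsTopologicalGroup G] : TopologicalSpace (SmoothDualSpace G) where
  IsOpen s := ∀ π : IrrSmoothRep G, mk π ∈ s →
    ∃ (n : ℕ) (v : Fin n → π.V) (ξ : Fin n → π.ρ.smoothDual) (B : Set G) (ε : ℝ),
      IsCompact B ∧ 0 < ε ∧ fellNhd π v ξ B ε ⊆ s
  isOpen_univ := fun _ _ =>
    ⟨0, Fin.elim0, Fin.elim0, ∅, 1, isCompact_empty, one_pos, Set.subset_univ _⟩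
  isOpen_inter := by
    intro s t hs ht π hπ
    obtain ⟨n, v, ξ, B, ε, hB, hε, h⟩ := hs π hπ.1
    obtain ⟨n', v', ξ', B', ε', hB', hε', h'⟩ := ht π hπ.2
    refine ⟨n + n', Fin.append v v', Fin.append ξ ξ', B ∪ B', min ε ε', hB.union hB',
      lt_min hε hε', ?_⟩
    rintro x ⟨σ, rfl, w, ζ, hw⟩
    constructor
    · refine h ⟨σ, rfl, fun j => w (Fin.castAdd n' j), fun j => ζ (Fin.castAdd n' j), ?_⟩
      intro j g hg
      have := hw (Fin.castAdd n' j) g (Or.inl hg)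
      rw [Fin.append_left, Fin.append_left] at this
      exact this.trans_le (min_le_left _ _)
    · refine h' ⟨σ, rfl, fun j => w (Fin.natAdd n j), fun j => ζ (Fin.natAdd n j), ?_⟩
      intro j g hg
      have := hw (Fin.natAdd n j) g (Or.inr hg)
      rw [Fin.append_right, Fin.append_right] at this
      exact this.trans_le (min_le_right _ _)
  isOpen_sUnion := by
    rintro S hS π ⟨s, hs, hπ⟩
    obtain ⟨n, v, ξ, B, ε, hB, hε, h⟩ := hS s hs π hπ
    exact ⟨n, v, ξ, B, ε, hB, hε, h.trans (Set.subset_sUnion_of_mem hs)⟩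

/-- The sets `U(π, v, ξ, B, ε)` are open, so they do form a basis of neighborhoods of `π`. -/
theorem isOpen_fellNhd [IsTopologicalGroup G] (π : IrrSmoothRep G) {n : ℕ} (v : Fin n → π.V)
    (ξ : Fin n → π.ρ.smoothDual) {B : Set G} (hB : IsCompact B) (ε : ℝ) :
    IsOpen (fellNhd π v ξ B ε) := by
  rintro σ ⟨τ, hτ, w, ζ, h⟩
  obtain ⟨e⟩ : Nonempty (τ.ρ.Equiv σ.ρ) := Quotient.exact hτ
  have hcoeff : ∀ (α : IrrSmoothRep G) (a : α.V) (f : Module.Dual ℂ α.V),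
      Continuous fun g => f (α.ρ g a) := by
    intro α a f
    let _ : TopologicalSpace α.V := ⊥
    have : DiscreteTopology α.V := ⟨rfl⟩
    have h₁ : Continuous fun p : G × α.V => α.ρ p.1 p.2 := α.smooth
    exact (continuous_of_discreteTopology (f := f)).comp
      (h₁.comp (Continuous.prodMk continuous_id continuous_const))
  have hδ : ∀ j, ∃ δ > 0, ∀ g ∈ B, ‖(ξ j : Module.Dual ℂ π.V) (π.ρ g (v j)) -
      (ζ j : Module.Dual ℂ τ.V) (τ.ρ g (w j))‖ + δ ≤ ε := by
    intro j
    rcases B.eq_empty_or_nonempty with rfl | hne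
    · exact ⟨1, one_pos, by simp⟩
    · obtain ⟨g₀, hg₀, hmax⟩ := hB.exists_isMaxOn hne
        ((hcoeff π (v j) (ξ j)).sub (hcoeff τ (w j) (ζ j))).norm.continuousOn
      refine ⟨_, sub_pos.2 (h j g₀ hg₀), fun g hg => ?_⟩
      have := hmax hg
      simp only [Set.mem_ofPred_eq, Pi.sub_apply] at this
      linarith
  choose δ hδ₀ hδ using hδ
  obtain ⟨d, hd₀, hd⟩ : ∃ d > 0, ∀ j, d ≤ δ j := by
    rcases isEmpty_or_nonempty (Fin n) with hn | hn
    · exact ⟨1, one_pos, fun j => hn.elim j⟩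
    · obtain ⟨j₀, hj₀⟩ := Finite.exists_min δ
      exact ⟨δ j₀, hδ₀ j₀, hj₀⟩
  -- transport the witnesses along the isomorphism `e`
  obtain ⟨E, hE⟩ : ∃ E : σ.V ≃ₗ[ℂ] τ.V, ∀ g x, E (σ.ρ g x) = τ.ρ g (E x) :=
    ⟨e.symm.toLinearEquiv, fun g x => e.symm.toIntertwiningMap.isIntertwining _ _ g x⟩
  have hζ : ∀ j, (ζ j : Module.Dual ℂ τ.V) ∘ₗ E.toLinearMap ∈ σ.ρ.smoothDual := by
    intro j
    have hj : IsOpen {g : G | τ.ρ.dual g (ζ j : Module.Dual ℂ τ.V) = ζ j} := (ζ j).2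
    have : {g : G | σ.ρ.dual g ((ζ j : Module.Dual ℂ τ.V) ∘ₗ E.toLinearMap) =
        (ζ j : Module.Dual ℂ τ.V) ∘ₗ E.toLinearMap} =
        {g : G | τ.ρ.dual g (ζ j : Module.Dual ℂ τ.V) = ζ j} := by
      ext g
      constructor
      · intro hg
        refine LinearMap.ext fun x => ?_
        have := LinearMap.congr_fun hg (E.symm x)
        simpa [Module.Dual.transpose_apply, hE] using this
      · intro hg
        refine LinearMap.ext fun x => ?_
        have := LinearMap.congr_fun hg (E x)
        simpa [Module.Dual.transpose_apply, hE] using this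
    change IsOpen {g : G | σ.ρ.dual g ((ζ j : Module.Dual ℂ τ.V) ∘ₗ E.toLinearMap) =
        (ζ j : Module.Dual ℂ τ.V) ∘ₗ E.toLinearMap}
    rw [this]
    exact hj
  refine ⟨n, fun j => E.symm (w j), fun j => ⟨_, hζ j⟩, B, d, hB, hd₀, ?_⟩
  rintro x ⟨κ, rfl, w', ζ', h'⟩
  refine ⟨κ, rfl, w', ζ', fun j g hg => ?_⟩
  have h₂ := h' j g hg
  simp only [LinearMap.comp_apply, LinearEquiv.coe_coe, hE, LinearEquiv.apply_symm_apply] at h₂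
  have h₃ := hδ j g hg
  calc _ ≤ _ := norm_sub_le_norm_sub_add_norm_sub _
        ((ζ j : Module.Dual ℂ τ.V) (τ.ρ g (w j))) _
    _ < _ := by linarith [hd j]

end SmoothDualSpace

/-! To separate `π` from a non-isomorphic `σ`, take `v ≠ 0` in `π` fixed by a compact open subgroup
`K`. Admissibility makes `σ^K` finite-dimensional, so the density-type argument in
`exists_sum_smul_eq_zero_and_ne_zero` gives `a ∈ ℂ[G]` that kills `σ^K` but not `v`. Choose a smooth
functional `ξ` with `ξ(a v) ≠ 0`.

Suppose a coefficient of `σ` is within `ε` of `⟨ξ, π(g) v⟩` on `supp(a) K`. Since `v` is `K`-fixed,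
averaging the vector of `σ` over `K` keeps the estimate on `supp(a)` and lands in `σ^K`, where `a`
acts by zero. Hence `|ξ(a v)| ≤ ε ∑ |a_g|`, which is false for small `ε`. -/

/-- If every scalar killing a finite family of vectors of a simple module `M` kills a nonzero vector
of a simple module `N`, then `M` and `N` are isomorphic. -/
theorem IsSimpleModule.nonempty_linearEquiv_of_annihilator_le {R M N ι : Type*} [Ring R]
    [AddCommGroup M] [Module R M] [AddCommGroup N] [Module R N] [IsSimpleModule R M]
    [IsSimpleModule R N] [Finite ι] (w : ι → M) {n : N} (hn : n ≠ 0)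
    (h : ∀ r : R, (∀ i, r • w i = 0) → r • n = 0) : Nonempty (M ≃ₗ[R] N) := by
  classical
  have := Fintype.ofFinite ι
  let F := LinearMap.toSpanSingleton R (ι → M) w
  let E := LinearMap.toSpanSingleton R N n
  have hFE : LinearMap.ker F ≤ LinearMap.ker E := fun r hr => h r fun i => congrFun hr i
  -- `R / Ann(w)` embeds in the semisimple module `M^ι` through `r ↦ r • w`, so the map `r ↦ r • n`
  -- on it extends to all of `M^ι`.
  obtain ⟨φ, hφ⟩ := IsSemisimpleModule.extension_property
    ((LinearMap.ker F).liftQ F le_rfl)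
    (LinearMap.ker_eq_bot.1 (Submodule.ker_liftQ_eq_bot _ _ _ le_rfl))
    ((LinearMap.ker F).liftQ E hFE)
  have hφw : φ w = n := by
    simpa [F, E] using LinearMap.congr_fun hφ (Submodule.Quotient.mk 1)
  -- As `φ w = n ≠ 0`, some component `M → N` of `φ` is nonzero, hence bijective by Schur's lemma.
  obtain ⟨i, hi⟩ : ∃ i, φ ∘ₗ LinearMap.single R (fun _ => M) i ≠ 0 := by
    by_contra! hzero
    refine hn (hφw ▸ ?_)
    have : φ = 0 := LinearMap.pi_ext' fun i => by simpa using hzero i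
    simp [this]
  exact ⟨.ofBijective _ (LinearMap.bijective_of_ne_zero hi)⟩

namespace Representation

/-! ### Separating irreducible representations by the group algebra -/

section Separation

variable {G V W : Type*} [Group G] [AddCommGroup V] [Module ℂ V] [AddCommGroup W] [Module ℂ W]

theorem asAlgebraHom_apply_eq_sum (ρ : Representation ℂ G V) (a : MonoidAlgebra ℂ G) (v : V) :
    ρ.asAlgebraHom a v = ∑ g ∈ a.coeff.support, a.coeff g • ρ g v := by
  simp [asAlgebraHom_def, MonoidAlgebra.lift_apply, Finsupp.sum, LinearMap.sum_apply]

/-- Two non-isomorphic irreducible representations are separated by a linear combination of group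
elements that kills a prescribed finite-dimensional space of vectors in the first but not a
prescribed nonzero vector in the second. -/
theorem exists_sum_smul_eq_zero_and_ne_zero {σ : Representation ℂ G V} {π : Representation ℂ G W}
    (hσ : σ.IsIrreducible) (hπ : π.IsIrreducible) (hne : ¬ Nonempty (σ.Equiv π))
    (U : Submodule ℂ V) [FiniteDimensional ℂ U] {v : W} (hv : v ≠ 0) :
    ∃ (s : Finset G) (c : G → ℂ), (∀ w ∈ U, ∑ g ∈ s, c g • σ g w = 0) ∧
      ∑ g ∈ s, c g • π g v ≠ 0 := by
  by_contra! hcon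
  let b := Module.finBasis ℂ U
  obtain ⟨e⟩ : Nonempty (σ.asModule ≃ₗ[MonoidAlgebra ℂ G] π.asModule) := by
    refine IsSimpleModule.nonempty_linearEquiv_of_annihilator_le
      (fun i => σ.asModuleEquiv.symm (b i : V)) (n := π.asModuleEquiv.symm v) (by simpa using hv)
      fun a ha => ?_
    have hb : ∀ i, σ.asAlgebraHom a (b i) = 0 := fun i => by
      simpa [asModuleEquiv_map_smul] using congrArg σ.asModuleEquiv (ha i)
    apply π.asModuleEquiv.injective
    rw [asModuleEquiv_map_smul, LinearEquiv.apply_symm_apply, map_zero, asAlgebraHom_apply_eq_sum]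
    refine hcon _ _ fun w hw => ?_
    rw [← asAlgebraHom_apply_eq_sum]
    have : σ.asAlgebraHom a ∘ₗ U.subtype = 0 := b.ext fun i => by simpa using hb i
    exact LinearMap.congr_fun this ⟨w, hw⟩
  let f : IntertwiningMap σ π := (IntertwiningMap.equivLinearMapAsModule σ π).symm e.toLinearMap
  refine hne ⟨f.ofBijective ?_⟩
  refine (IsIrreducible.bijective_or_eq_zero f).resolve_right fun hf => ?_
  have he : e.toLinearMap = 0 := by
    simpa [f] using hf
  have : π.asModuleEquiv.symm v = 0 := by
    rw [← e.apply_symm_apply (π.asModuleEquiv.symm v)]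
    exact LinearMap.congr_fun he _
  exact hv (by simpa using this)

end Separation

/-- The stabilizer of a vector. -/
def stabilizer {G V : Type*} [Group G] [AddCommGroup V] [Module ℂ V]
    (ρ : Representation ℂ G V) (v : V) : Subgroup G where
  carrier := {g | ρ g v = v}
  one_mem' := by simp
  mul_mem' := by
    intro g h hg hh
    simp_all
  inv_mem' := by
    intro g hg
    change ρ g⁻¹ v = v
    nth_rewrite 1 [← show ρ g v = v from hg]
    simp

/-! ### Averaging and smooth functionals -/

section Smooth

variable {G : Type*} [Group G] [TopologicalSpace G] {V : Type*} [AddCommGroup V] [Module ℂ V]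
  {ρ : Representation ℂ G V}

theorem IsSmooth.isLocallyConstant (hρ : ρ.IsSmooth) (v : V) :
    IsLocallyConstant fun g => ρ g v := by
  let _ : TopologicalSpace V := ⊥
  have : DiscreteTopology V := ⟨rfl⟩
  have h : Continuous fun p : G × V => ρ p.1 p.2 := hρ
  exact (IsLocallyConstant.iff_continuous _).2
    (h.comp (Continuous.prodMk continuous_id continuous_const))

theorem IsSmooth.isOpen_stabilizer (hρ : ρ.IsSmooth) (v : V) :
    IsOpen (ρ.stabilizer v : Set G) :=
  (hρ.isLocallyConstant v).isOpen_fiber v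

theorem IsSmooth.finite_orbit (hρ : ρ.IsSmooth) {K : Set G} (hK : IsCompact K) (v : V) :
    ((fun k => ρ k v) '' K).Finite := by
  let _ : TopologicalSpace V := ⊥
  have : DiscreteTopology V := ⟨rfl⟩
  exact (hK.image (hρ.isLocallyConstant v).continuous).finite_of_discrete

/-- Every vector of a smooth representation is fixed by a compact open subgroup. -/
theorem IsSmooth.exists_isCompactOpen_fixing [IsTopologicalGroup G] (hρ : ρ.IsSmooth)
    {K : Subgroup G} (hK : K.IsCompactOpen) (v : V) :
    ∃ L : Subgroup G, L.IsCompactOpen ∧ ∀ g ∈ L, ρ g v = v := by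
  have hS : IsOpen (ρ.stabilizer v : Set G) := hρ.isOpen_stabilizer v
  exact ⟨K ⊓ ρ.stabilizer v, ⟨hK.1.inter_right (Subgroup.isClosed_of_isOpen _ hS), hK.2.inter hS⟩, fun g hg => hg.2⟩

/-- The average of a vector over its orbit under a compact subgroup `K` is fixed by `K`, and
linear functionals take on it a value that is an average of their values on the orbit. -/
theorem IsSmooth.exists_average (hρ : ρ.IsSmooth) {K : Subgroup G}
    (hK : IsCompact (K : Set G)) (v : V) :
    ∃ v' : V, (∀ k ∈ K, ρ k v' = v') ∧ ∀ (f : Module.Dual ℂ V) (c : ℂ) (ε : ℝ),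
      (∀ k ∈ K, ‖c - f (ρ k v)‖ ≤ ε) → ‖c - f v'‖ ≤ ε := by
  classical
  -- The orbit is finite, so a plain mean over it serves as the average; `K` permutes its points.
  let O := (hρ.finite_orbit hK v).toFinset
  have hO : ∀ y, y ∈ O ↔ ∃ k ∈ K, ρ k v = y := fun y => by simp [O]
  have hcard : 0 < O.card := Finset.card_pos.2 ⟨v, (hO v).2 ⟨1, K.one_mem, by simp⟩⟩
  have hcard' : (O.card : ℂ) ≠ 0 := by exact_mod_cast hcard.ne'
  refine ⟨(O.card : ℂ)⁻¹ • ∑ y ∈ O, y, fun k hk => ?_, fun f c ε h => ?_⟩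
  · rw [map_smul, map_sum]
    congr 1
    refine Finset.sum_nbij' (fun y => ρ k y) (fun y => ρ k⁻¹ y) ?_ ?_ ?_ ?_ ?_
    · intro y hy
      obtain ⟨l, hl, rfl⟩ := (hO y).1 hy
      exact (hO _).2 ⟨k * l, K.mul_mem hk hl, by simp⟩
    · intro y hy
      obtain ⟨l, hl, rfl⟩ := (hO y).1 hy
      exact (hO _).2 ⟨k⁻¹ * l, K.mul_mem (K.inv_mem hk) hl, by simp⟩
    all_goals simp
  · have hsum : c - f ((O.card : ℂ)⁻¹ • ∑ y ∈ O, y) = (O.card : ℂ)⁻¹ * ∑ y ∈ O, (c - f y) := by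
      rw [Finset.sum_sub_distrib, Finset.sum_const, map_smul, map_sum, mul_sub, nsmul_eq_mul,
        inv_mul_cancel_left₀ hcard', smul_eq_mul]
    rw [hsum, norm_mul, norm_inv, Complex.norm_natCast,
      inv_mul_le_iff₀ (by exact_mod_cast hcard), ← nsmul_eq_mul]
    refine norm_sum_le_of_le _ (fun y hy => ?_) |>.trans_eq (Finset.sum_const ε)
    obtain ⟨k, hk, rfl⟩ := (hO y).1 hy
    exact h k hk

open MeasureTheory in
/-- The smooth dual of a smooth representation separates points. -/
theorem IsSmooth.exists_smoothDual_apply_ne_zero [IsTopologicalGroup G] (hρ : ρ.IsSmooth)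
    {K : Subgroup G} (hK : K.IsCompactOpen) {v : V} (hv : v ≠ 0) :
    ∃ ξ : ρ.smoothDual, (ξ : Module.Dual ℂ V) v ≠ 0 := by
  obtain ⟨L, hL, hLv⟩ := hρ.exists_isCompactOpen_fixing hK v
  obtain ⟨f, hfv⟩ := Module.Projective.exists_dual_ne_zero ℂ hv
  have : CompactSpace L := isCompact_iff_compactSpace.1 hL.1
  let _ : MeasurableSpace L := borel L
  have : BorelSpace L := ⟨rfl⟩
  let μ : Measure L := Measure.haar
  -- `ξ` will be the Haar average of `f` over `L`; the inverse on `k` turns `L`-invariance of `ξ`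
  -- into left invariance of the measure.
  have hcont : ∀ x, Continuous fun k : L => f (ρ (k⁻¹ : L) x) := fun x =>
    ((hρ.isLocallyConstant x).comp f).continuous.comp (by fun_prop)
  have hint : ∀ x, Integrable (fun k : L => f (ρ (k⁻¹ : L) x)) μ := fun x =>
    (hcont x).integrable_of_hasCompactSupport (.of_compactSpace _)
  let ξ : Module.Dual ℂ V :=
    { toFun := fun x => ∫ k : L, f (ρ (k⁻¹ : L) x) ∂μ
      map_add' := fun x y => by simpa using integral_add (hint x) (hint y)
      map_smul' := fun c x => by simp [integral_const_mul] }
  have hξ : ∀ g ∈ L, ∀ x, ξ (ρ g x) = ξ x := fun g hg x => by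
    have := integral_mul_left_eq_self (μ := μ) (fun k : L => f (ρ (k⁻¹ : L) x)) ⟨g, hg⟩⁻¹
    simpa [ξ] using this
  refine ⟨⟨ξ, ?_⟩, ?_⟩
  · have hLξ : L ≤ ρ.dual.stabilizer ξ := fun g hg =>
      LinearMap.ext fun x => hξ g⁻¹ (L.inv_mem hg) x
    exact Subgroup.isOpen_mono hLξ hL.2
  -- `L` fixes `v`, so the integrand is constant and `ξ v` is `f v` times the nonzero volume of `L`.
  · have hconst : ∀ k : L, f (ρ (k⁻¹ : L) v) = f v := fun k => by rw [hLv _ (k⁻¹).2]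
    have hξv : ξ v = μ.real Set.univ • f v := by
      change ∫ k : L, f (ρ (k⁻¹ : L) v) ∂μ = _
      rw [funext hconst, integral_const]
    change ξ v ≠ 0
    simp [hξv, hfv, measureReal_eq_zero_iff, NeZero.ne μ]

end Smooth

end Representation

/-! ### Fell neighborhoods and closed points -/

namespace SmoothDualSpace

open Representation

variable {G : Type u} [Group G] [TopologicalSpace G] [IsTopologicalGroup G]

/-- An admissible irreducible representation has a Fell neighborhood of each other irreducible
smooth representation avoiding it. -/
theorem exists_fellNhd_notMem {π σ : IrrSmoothRep G} (hσ : σ.ρ.IsAdmissible)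
    (hne : mk π ≠ mk σ) {K₀ : Subgroup G} (hK₀ : K₀.IsCompactOpen) :
    ∃ (v : π.V) (ξ : π.ρ.smoothDual) (B : Set G) (ε : ℝ), IsCompact B ∧ 0 < ε ∧
      mk σ ∉ fellNhd π (fun _ : Fin 1 => v) (fun _ => ξ) B ε := by
  have := π.irreducible
  have : Nontrivial π.V := by
    have := IsSimpleModule.nontrivial (MonoidAlgebra ℂ G) π.ρ.asModule
    exact π.ρ.asModuleEquiv.symm.toEquiv.nontrivial
  obtain ⟨v, hv⟩ := exists_ne (0 : π.V)
  obtain ⟨K, hK, hKv⟩ := π.smooth.exists_isCompactOpen_fixing hK₀ v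
  have := hσ.2 K hK
  obtain ⟨s, c, hσs, hπs⟩ := exists_sum_smul_eq_zero_and_ne_zero σ.irreducible π.irreducible
    (fun ⟨e⟩ => hne (Quotient.sound ⟨e.symm⟩)) (invariants (σ.ρ.comp K.subtype)) hv
  obtain ⟨ξ, hξ⟩ := π.smooth.exists_smoothDual_apply_ne_zero hK hπs
  set a := (ξ : Module.Dual ℂ π.V) (∑ g ∈ s, c g • π.ρ g v) with ha
  have hC : 0 < ∑ g ∈ s, ‖c g‖ + 1 := by positivity
  -- `B = sK` leaves room for averaging over `K`. The `+ 1` keeps the denominator positive and makes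
  -- the final inequality strict.
  refine ⟨v, ξ, ⋃ g ∈ s, (fun k => g * k) '' (K : Set G), ‖a‖ / (∑ g ∈ s, ‖c g‖ + 1),
    s.isCompact_biUnion fun g _ => hK.1.image (continuous_const_mul g),
    div_pos (norm_pos_iff.2 hξ) hC, ?_⟩
  rintro ⟨τ, hτ, w, ζ, hw⟩
  obtain ⟨e⟩ : Nonempty (τ.ρ.Equiv σ.ρ) := Quotient.exact hτ
  have he : ∀ g x, e (τ.ρ g x) = σ.ρ g (e x) := fun g x =>
    e.toIntertwiningMap.isIntertwining _ _ g x
  -- `w'` is `K`-fixed, so its image under `e` lies in `σ^K`, which the combination kills.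
  obtain ⟨w', hw'K, hw'⟩ := τ.smooth.exists_average hK.1 (w 0)
  have hτs : ∑ g ∈ s, c g • τ.ρ g w' = 0 := by
    apply e.toLinearEquiv.injective
    rw [map_zero, ← hσs (e w') fun k => (he k w').symm.trans (congrArg e (hw'K k k.2)), map_sum]
    refine Finset.sum_congr rfl fun g _ => ?_
    rw [map_smul, ← he]
    rfl
  have hbound : ∀ g ∈ s, ‖(ξ : Module.Dual ℂ π.V) (π.ρ g v) -
      (ζ 0 : Module.Dual ℂ τ.V) (τ.ρ g w')‖ ≤ ‖a‖ / (∑ g ∈ s, ‖c g‖ + 1) := fun g hg =>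
    hw' ((ζ 0 : Module.Dual ℂ τ.V) ∘ₗ τ.ρ g) _ _ fun k hk => by
      have := hw 0 (g * k) (Set.mem_biUnion hg ⟨k, hk, rfl⟩)
      simpa [hKv k hk] using this.le
  have hdiff : a = ∑ g ∈ s, c g * ((ξ : Module.Dual ℂ π.V) (π.ρ g v) -
      (ζ 0 : Module.Dual ℂ τ.V) (τ.ρ g w')) := by
    have hzero := congrArg (ζ 0 : Module.Dual ℂ τ.V) hτs
    simp only [map_sum, map_smul, smul_eq_mul, map_zero] at hzero
    simp only [mul_sub, Finset.sum_sub_distrib, hzero, sub_zero, ha, map_sum, map_smul,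
      smul_eq_mul]
  have hle : ‖a‖ ≤ (∑ g ∈ s, ‖c g‖) * (‖a‖ / (∑ g ∈ s, ‖c g‖ + 1)) := by
    conv_lhs => rw [hdiff]
    rw [Finset.sum_mul]
    refine norm_sum_le_of_le _ fun g hg => ?_
    rw [norm_mul]
    exact mul_le_mul_of_nonneg_left (hbound g hg) (norm_nonneg _)
  -- With `C = ∑ ‖c g‖`, the bound `‖a‖ (C + 1) ≤ C ‖a‖` contradicts `a ≠ 0`.
  rw [← mul_div_assoc, le_div_iff₀ hC] at hle
  nlinarith [norm_pos_iff.2 hξ]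

end SmoothDualSpace

theorem mainTheorem9 (G : Type u) [Group G] [TopologicalSpace G] [IsLcGroup G]
    (hG : IsTame G) : T1Space (SmoothDualSpace G) := by
  refine ⟨fun x => ?_⟩
  obtain ⟨σ, rfl⟩ := Quotient.exists_rep x
  obtain ⟨K, hK, -⟩ := IsLcGroup.exists_mem_compactOpen (1 : G)
  refine ⟨fun π hπ => ?_⟩
  obtain ⟨v, ξ, B, ε, hB, hε, h⟩ := SmoothDualSpace.exists_fellNhd_notMem
    (hG σ.V σ.ρ σ.irreducible σ.smooth) hπ hK
  refine ⟨1, fun _ => v, fun _ => ξ, B, ε, hB, hε, ?_⟩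
  rintro _ hy rfl
  exact h hy
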